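/- For a finite simple graph $G=(V,E)$ and vertex subsets $X,Y\subseteq V$ (not necessarily disjoint), let $e(X,Y)$ be the number of pairs $(x,y)\in X\times Y$ that are edges of $G$, let $d(X,Y)=e(X,Y)/(|X||Y|)$ for nonempty $X,Y$, and put $$\mathrm{irreg}(X,Y)=\max_{U\subseteq X,\ W\subseteq Y}\bigl|e(U,W)-|U||W|\,d(X,Y)\bigr| .$$ The irregularity of a partition $\mathcal P$ of $V$ into nonempty parts is $\mathrm{irreg}(\mathcal P)=\sum_{X,Y\in\mathcal P}\mathrm{irreg}(X,Y)$, the sum being over all ordered pairs of parts, including $X=Y$. A partition is equitable if any two of its parts differ in size by at most one. For $\epsilon>0$ let $M(\epsilon)$ be the smallest integer $m$ such that every finite graph $G=(V,E)$ has a vertex partition into at most $m$ parts with irregularity at most $\epsilon|V|^2$, and let $M_{eq}(\epsilon)$ be the smallest integer $m$ such that every finite graph $G=(V,E)$ has an equitable vertex partition into at most $m$ parts with irregularity at most $\epsilon|V|^2$. **Theorem 2.2.** There is an absolute constant $C>0$ such that for all real $0<\epsilon<1$ and $0<\alpha<1/2$ the integers $M(\epsilon)$ and $M_{eq}(\epsilon+\alpha)$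 exist and $$M_{eq}(\epsilon+\alpha)\le \alpha^{-C}\,M(\epsilon).$$ -/

import Mathlib

open Finset

noncomputable section

namespace EquitableRegularity

/-- The irregularity of a pair `X, Y` of (not necessarily disjoint) vertex subsets of `G`:
the maximum of `|e(U, W) - |U| |W| d(X, Y)|` over all `U ⊆ X` and `W ⊆ Y`, where `e(U, W)` is the
number of pairs `(u, w) ∈ U × W` that are edges and `d(X, Y) = e(X, Y) / (|X| |Y|)`. -/
def pairIrreg {V : Type} (G : SimpleGraph V) [DecidableRel G.Adj] (X Y : Finset V) : ℝ :=
  (X.powerset ×ˢ Y.powerset).sup'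
    ((Finset.powerset_nonempty X).product (Finset.powerset_nonempty Y))
    fun p => |(#(G.interedges p.1 p.2) : ℝ) - (#p.1 : ℝ) * (#p.2 : ℝ) * (G.edgeDensity X Y : ℝ)|

/-- The irregularity of a vertex partition: the sum of the irregularities of all ordered pairs
`(X, Y)` of parts, the pairs with `X = Y` included. -/
def irreg {V : Type} [Fintype V] [DecidableEq V] (G : SimpleGraph V) [DecidableRel G.Adj]
    (P : Finpartition (univ : Finset V)) : ℝ :=
  ∑ X ∈ P.parts, ∑ Y ∈ P.parts, pairIrreg G X Y

/-- The numbers `m` such that every finite graph `G = (V, E)` has a vertex partition into at most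
`m` parts with irregularity at most `ε |V| ^ 2`. -/
def sufficientParts (ε : ℝ) : Set ℕ :=
  {m | ∀ (V : Type) [Fintype V] [DecidableEq V] (G : SimpleGraph V) [DecidableRel G.Adj],
    ∃ P : Finpartition (univ : Finset V),
      #P.parts ≤ m ∧ irreg G P ≤ ε * (Fintype.card V : ℝ) ^ 2}

/-- The numbers `m` such that every finite graph `G = (V, E)` has an equitable vertex partition
(any two parts differ in size by at most one) into at most `m` parts with irregularity at most
`ε |V| ^ 2`. -/
def sufficientEquitableParts (ε : ℝ) : Set ℕ :=
  {m | ∀ (V : Type) [Fintype V] [DecidableEq V] (G : SimpleGraph V) [DecidableRel G.Adj],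
    ∃ P : Finpartition (univ : Finset V),
      P.IsEquipartition ∧ #P.parts ≤ m ∧ irreg G P ≤ ε * (Fintype.card V : ℝ) ^ 2}

/-- `M(ε)`: the least number of parts that always suffices. -/
def M (ε : ℝ) : ℕ := sInf (sufficientParts ε)

/-- `M_eq(ε)`: the least number of parts that always suffices for equitable partitions. -/
def Meq (ε : ℝ) : ℕ := sInf (sufficientEquitableParts ε)

end EquitableRegularity

end

/-!
Let `P` be a partition of `V` into `k` parts. Cut each part into as many blocks of `t` vertices as
fit, at random: arrange the `K` blocks as the columns of a grid with `t` rows, and permute every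
row independently within each part. A block is then a random transversal of the columns of its
part, and Rademacher symmetrization shows that the expected irregularity of a pair of blocks
exceeds its share of the irregularity of the pair of parts by only `O(t√t)`. The fewer than `k * t`
leftover vertices are distributed evenly among the blocks, which yields an equitable partition `Q`
with, up to constants, `irreg Q ≤ irreg P + K² t√t + K t² + k t |V|`. Choosing `t` of order
`α |V| / k` makes the error at most `α |V|²`, with `K = O(k / α)` blocks; graphs so small that
`t√t` is not negligible against `α t²` are partitioned into singletons. That `M(ε)` exists at all
is Szemerédi's regularity lemma.
-/

noncomputable section

namespace EquitableRegularity

open scoped BigOperators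

section Symmetrization

/-- The sign `±1` encoded by a Boolean, used for Rademacher variables and for writing an absolute
value as a maximum over two signs. -/
def sgn (s : Bool) : ℝ := cond s 1 (-1)

lemma abs_sgn (s : Bool) : |sgn s| = 1 := by cases s <;> simp [sgn]

lemma sgn_mul_le_abs (s : Bool) (x : ℝ) : sgn s * x ≤ |x| :=
  (le_abs_self _).trans_eq (by rw [abs_mul, abs_sgn, one_mul])

lemma expect_fin_cons {Ω : Type*} [Fintype Ω] {n : ℕ} (F : (Fin (n + 1) → Ω) → ℝ) :
    𝔼 z, F z = 𝔼 a, 𝔼 z : Fin n → Ω, F (Fin.cons a z) := by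
  rw [← expect_product', univ_product_univ]
  exact (Fintype.expect_equiv (Fin.consEquiv fun _ => Ω) _ _ fun _ => rfl).symm

lemma expect_prod_bool {Ω : Type*} [Fintype Ω] (F : Ω × Bool → ℝ) :
    𝔼 w, F w = 𝔼 a, (F (a, true) + F (a, false)) / 2 := by
  rw [← univ_product_univ, expect_product]
  exact expect_congr rfl fun a _ => by
    rw [Fintype.expect_eq_sum_div_card]
    simp

variable {T Ω : Type*} [Finite T] [Nonempty T]

lemma ciSup_add_ciSup_sub_le {g h : T → ℝ} (hgh : ∀ τ τ', |g τ - g τ'| ≤ |h τ - h τ'|)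
    (b : T → ℝ) :
    (⨆ τ, (b τ + g τ)) + (⨆ τ, (b τ - g τ)) ≤ (⨆ τ, (b τ + h τ)) + ⨆ τ, (b τ - h τ) := by
  obtain ⟨τ, hτ⟩ := exists_eq_ciSup_of_finite (f := fun τ => b τ + g τ)
  obtain ⟨τ', hτ'⟩ := exists_eq_ciSup_of_finite (f := fun τ => b τ - g τ)
  rw [← hτ, ← hτ']
  have hadd := Finite.le_ciSup fun τ => b τ + h τ
  have hsub := Finite.le_ciSup fun τ => b τ - h τ
  have hdiff := (le_abs_self _).trans (hgh τ τ')
  rcases abs_cases (h τ - h τ') with habs | habs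
  · linarith [hadd τ, hsub τ']
  · linarith [hadd τ', hsub τ]

variable [Fintype Ω] [Nonempty Ω]

lemma expect_ciSup_add_sub_expect_le {g h : T → Ω → ℝ}
    (hgh : ∀ a τ τ', |g τ a - g τ' a| ≤ |h τ a - h τ' a|) (b : T → ℝ) :
    𝔼 a, ⨆ τ, (b τ + (g τ a - 𝔼 a', g τ a')) ≤
      𝔼 w : Ω × Bool, ⨆ τ, (b τ + 2 * (sgn w.2 * h τ w.1)) := by
  -- The centred sum `b + (g a - 𝔼 g)` is the midpoint of `b + 2 g a` and `𝔼 (b - 2 g)`.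
  have hmid : ∀ a, (⨆ τ, (b τ + (g τ a - 𝔼 a', g τ a'))) ≤
      ((⨆ τ, (b τ + 2 * g τ a)) + 𝔼 a', ⨆ τ, (b τ - 2 * g τ a')) / 2 := by
    refine fun a => ciSup_le fun τ => ?_
    have hplus := Finite.le_ciSup (fun τ => b τ + 2 * g τ a) τ
    have hminus : 𝔼 a', (b τ - 2 * g τ a') ≤ 𝔼 a', ⨆ τ, (b τ - 2 * g τ a') :=
      expect_le_expect fun a' _ => Finite.le_ciSup (fun τ => b τ - 2 * g τ a') τ
    rw [expect_sub_distrib, Fintype.expect_const, ← mul_expect] at hminus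
    linarith
  have hlip : ∀ a τ τ', |2 * g τ a - 2 * g τ' a| ≤ |2 * h τ a - 2 * h τ' a| := fun a τ τ' => by
    simpa only [← mul_sub, abs_mul] using mul_le_mul_of_nonneg_left (hgh a τ τ') (abs_nonneg 2)
  calc 𝔼 a, ⨆ τ, (b τ + (g τ a - 𝔼 a', g τ a'))
      ≤ 𝔼 a, ((⨆ τ, (b τ + 2 * g τ a)) + 𝔼 a', ⨆ τ, (b τ - 2 * g τ a')) / 2 :=
        expect_le_expect fun a _ => hmid a
    _ = 𝔼 a, ((⨆ τ, (b τ + 2 * g τ a)) + ⨆ τ, (b τ - 2 * g τ a)) / 2 := by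
        rw [← expect_div, ← expect_div, expect_add_distrib, expect_add_distrib,
          Fintype.expect_const]
    _ ≤ 𝔼 a, ((⨆ τ, (b τ + 2 * h τ a)) + ⨆ τ, (b τ - 2 * h τ a)) / 2 :=
        expect_le_expect fun a _ =>
          div_le_div_of_nonneg_right (ciSup_add_ciSup_sub_le (hlip a) b) zero_le_two
    _ = 𝔼 w : Ω × Bool, ⨆ τ, (b τ + 2 * (sgn w.2 * h τ w.1)) := by
        rw [expect_prod_bool]
        simp [sgn, sub_eq_add_neg]

lemma expect_ciSup_add_sum_sub_expect_le {n : ℕ} {g h : T → Fin n → Ω → ℝ}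
    (hgh : ∀ r a τ τ', |g τ r a - g τ' r a| ≤ |h τ r a - h τ' r a|) (b : T → ℝ) :
    𝔼 z : Fin n → Ω, ⨆ τ, (b τ + ∑ r, (g τ r (z r) - 𝔼 a, g τ r a)) ≤
      𝔼 w : Fin n → Ω × Bool, ⨆ τ, (b τ + ∑ r, 2 * (sgn (w r).2 * h τ r (w r).1)) := by
  induction n generalizing b with
  | zero => simp
  | succ n ih =>
    rw [expect_fin_cons, expect_fin_cons]
    simp only [Fin.sum_univ_succ, Fin.cons_zero, Fin.cons_succ, ← add_assoc]
    calc _ ≤ 𝔼 a, 𝔼 w : Fin n → Ω × Bool, ⨆ τ, (b τ + (g τ 0 a - 𝔼 a', g τ 0 a') +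
          ∑ r, 2 * (sgn (w r).2 * h τ r.succ (w r).1)) :=
          expect_le_expect fun a _ => ih (fun r => hgh r.succ) _
      _ = 𝔼 w : Fin n → Ω × Bool, 𝔼 a, ⨆ τ, (b τ +
          ∑ r, 2 * (sgn (w r).2 * h τ r.succ (w r).1) + (g τ 0 a - 𝔼 a', g τ 0 a')) := by
          rw [expect_comm]
          simp only [add_right_comm]
      _ ≤ 𝔼 w : Fin n → Ω × Bool, 𝔼 v : Ω × Bool, ⨆ τ, (b τ +
          ∑ r, 2 * (sgn (w r).2 * h τ r.succ (w r).1) + 2 * (sgn v.2 * h τ 0 v.1)) :=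
          expect_le_expect fun w _ => expect_ciSup_add_sub_expect_le (hgh 0) _
      _ = _ := by
          rw [expect_comm]
          simp only [add_right_comm]

lemma expect_ciSup_sum_le {n : ℕ} {g h : T → Fin n → Ω → ℝ}
    (hgh : ∀ r a τ τ', |g τ r a - g τ' r a| ≤ |h τ r a - h τ' r a|) :
    𝔼 z : Fin n → Ω, ⨆ τ, ∑ r, g τ r (z r) ≤ (⨆ τ, ∑ r, 𝔼 a, g τ r a) +
      𝔼 w : Fin n → Ω × Bool, ⨆ τ, 2 * ∑ r, sgn (w r).2 * h τ r (w r).1 := by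
  have hcentred := expect_ciSup_add_sum_sub_expect_le hgh 0
  simp only [Pi.zero_apply, zero_add, ← mul_sum] at hcentred
  calc 𝔼 z : Fin n → Ω, ⨆ τ, ∑ r, g τ r (z r)
      ≤ 𝔼 z : Fin n → Ω, ((⨆ τ, ∑ r, 𝔼 a, g τ r a) +
          ⨆ τ, ∑ r, (g τ r (z r) - 𝔼 a, g τ r a)) := by
        refine expect_le_expect fun z _ => ciSup_le fun τ => ?_
        have hmean := Finite.le_ciSup (fun τ => ∑ r, 𝔼 a, g τ r a) τ
        have hdev := Finite.le_ciSup (fun τ => ∑ r, (g τ r (z r) - 𝔼 a, g τ r a)) τ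
        rw [sum_sub_distrib] at hdev
        linarith
    _ = (⨆ τ, ∑ r, 𝔼 a, g τ r a) +
          𝔼 z : Fin n → Ω, ⨆ τ, ∑ r, (g τ r (z r) - 𝔼 a, g τ r a) := by
        rw [expect_add_distrib, Fintype.expect_const]
    _ ≤ _ := by gcongr

lemma expect_sq_sum_sgn_mul_le {n : ℕ} {c : ℝ} {g : Fin n → Ω → ℝ} (hg : ∀ r a, |g r a| ≤ c) :
    𝔼 w : Fin n → Ω × Bool, (∑ r, sgn (w r).2 * g r (w r).1) ^ 2 ≤ n * c ^ 2 := by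
  induction n with
  | zero => simp
  | succ n ih =>
    rw [expect_fin_cons, expect_comm]
    calc _ = 𝔼 w : Fin n → Ω × Bool, 𝔼 a,
          (g 0 a ^ 2 + (∑ r, sgn (w r).2 * g r.succ (w r).1) ^ 2) := by
          refine expect_congr rfl fun w _ => (expect_prod_bool _).trans ?_
          refine expect_congr rfl fun a _ => ?_
          simp only [Fin.sum_univ_succ, Fin.cons_zero, Fin.cons_succ, sgn, cond_true, cond_false]
          ring
      _ ≤ 𝔼 w : Fin n → Ω × Bool, (c ^ 2 + (∑ r, sgn (w r).2 * g r.succ (w r).1) ^ 2) := by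
          refine expect_le_expect fun w _ => expect_le univ_nonempty fun a _ => ?_
          exact add_le_add_left (sq_le_sq.2 ((hg 0 a).trans (le_abs_self c))) _
      _ ≤ c ^ 2 + n * c ^ 2 := by
          rw [expect_add_distrib, Fintype.expect_const]
          gcongr
          exact ih fun r => hg r.succ
      _ = (n + 1 : ℕ) * c ^ 2 := by push_cast; ring

lemma expect_abs_sum_sgn_mul_le {n : ℕ} {c : ℝ} (hc : 0 ≤ c) {g : Fin n → Ω → ℝ}
    (hg : ∀ r a, |g r a| ≤ c) :
    𝔼 w : Fin n → Ω × Bool, |∑ r, sgn (w r).2 * g r (w r).1| ≤ c * √n := by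
  refine le_of_sq_le_sq ?_ (by positivity)
  calc (𝔼 w : Fin n → Ω × Bool, |∑ r, sgn (w r).2 * g r (w r).1|) ^ 2
      ≤ 𝔼 w : Fin n → Ω × Bool, (∑ r, sgn (w r).2 * g r (w r).1) ^ 2 := by
        simpa [sq_abs] using expect_mul_sq_le_sq_mul_sq univ
          (fun w : Fin n → Ω × Bool => |∑ r, sgn (w r).2 * g r (w r).1|) 1
    _ ≤ n * c ^ 2 := expect_sq_sum_sgn_mul_le hg
    _ = (c * √n) ^ 2 := by rw [mul_pow, Real.sq_sqrt (Nat.cast_nonneg n), mul_comm]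

end Symmetrization

section CutNorm

variable {α β : Type*}

/-- The total weight of `f` on the rectangle `A × B`. -/
def rectSum (f : α → β → ℝ) (A : Finset α) (B : Finset β) : ℝ := ∑ x ∈ A, ∑ y ∈ B, f x y

/-- The (unnormalized) cut norm of `f` on `A × B`: the largest absolute weight of a rectangle
inside `A × B`. -/
def cutNorm (f : α → β → ℝ) (A : Finset α) (B : Finset β) : ℝ :=
  (A.powerset ×ˢ B.powerset).sup' ((powerset_nonempty A).product (powerset_nonempty B))
    fun p => |rectSum f p.1 p.2|

/-- The cut norm of `f` on `A × B` plus the absolute value of its total weight there. For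
`f x y = 1_{xy ∈ E} - c` the second term records how far `c` is from the density of `(A, B)`, so
this quantity bounds the irregularity of `(A, B)` even if `c` is the density of another pair. -/
def augCutNorm (f : α → β → ℝ) (A : Finset α) (B : Finset β) : ℝ := cutNorm f A B + |rectSum f A B|

variable (f : α → β → ℝ) (A : Finset α) (B : Finset β)

lemma rectSum_swap : rectSum (Function.swap f) B A = rectSum f A B := sum_comm

variable {f A B}

lemma abs_rectSum_le_cutNorm {U : Finset α} {W : Finset β} (hU : U ⊆ A) (hW : W ⊆ B) :
    |rectSum f U W| ≤ cutNorm f A B :=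
  le_sup' (fun p : Finset α × Finset β => |rectSum f p.1 p.2|)
    (mem_product.2 ⟨mem_powerset.2 hU, mem_powerset.2 hW⟩ : (U, W) ∈ _)

lemma cutNorm_le {c : ℝ} (h : ∀ U ⊆ A, ∀ W ⊆ B, |rectSum f U W| ≤ c) : cutNorm f A B ≤ c := by
  refine sup'_le _ _ fun p hp => ?_
  rw [mem_product, mem_powerset, mem_powerset] at hp
  exact h _ hp.1 _ hp.2

lemma cutNorm_mono {A' : Finset α} {B' : Finset β} (hA : A ⊆ A') (hB : B ⊆ B') :
    cutNorm f A B ≤ cutNorm f A' B' :=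
  cutNorm_le fun _ hU _ hW => abs_rectSum_le_cutNorm (hU.trans hA) (hW.trans hB)

lemma augCutNorm_nonneg : 0 ≤ augCutNorm f A B :=
  add_nonneg ((abs_nonneg _).trans (abs_rectSum_le_cutNorm Subset.rfl Subset.rfl)) (abs_nonneg _)

lemma cutNorm_swap_le : cutNorm (Function.swap f) B A ≤ cutNorm f A B :=
  cutNorm_le fun W hW U hU => by
    rw [rectSum_swap f U W]
    exact abs_rectSum_le_cutNorm hU hW

variable (f A B) in
lemma augCutNorm_swap : augCutNorm (Function.swap f) B A = augCutNorm f A B := by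
  rw [augCutNorm, augCutNorm, rectSum_swap,
    le_antisymm cutNorm_swap_le (cutNorm_swap_le (f := Function.swap f))]

lemma abs_rectSum_sub_rectSum_inter_le [DecidableEq α] [DecidableEq β] (hf : ∀ x y, |f x y| ≤ 1)
    {U A' : Finset α} {W B' : Finset β} (hU : U ⊆ A') (hW : W ⊆ B') (hA : A ⊆ A') (hB : B ⊆ B') :
    |rectSum f U W - rectSum f (U ∩ A) (W ∩ B)| ≤ (#A' * #B' - #A * #B : ℝ) := by
  have hinter : (U ∩ A) ×ˢ (W ∩ B) ⊆ U ×ˢ W :=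
    product_subset_product inter_subset_left inter_subset_left
  have hsub : (U ×ˢ W) \ ((U ∩ A) ×ˢ (W ∩ B)) ⊆ (A' ×ˢ B') \ (A ×ˢ B) := fun p hp => by
    simp only [mem_sdiff, mem_product, mem_inter] at hp ⊢
    exact ⟨⟨hU hp.1.1, hW hp.1.2⟩, fun h => hp.2 ⟨⟨hp.1.1, h.1⟩, hp.1.2, h.2⟩⟩
  have hcard := card_sdiff_add_card_eq_card (product_subset_product hA hB)
  rw [card_product, card_product] at hcard
  calc |rectSum f U W - rectSum f (U ∩ A) (W ∩ B)|
      = |∑ p ∈ (U ×ˢ W) \ ((U ∩ A) ×ˢ (W ∩ B)), f p.1 p.2| := by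
        rw [rectSum, rectSum, ← sum_product', ← sum_product', ← sum_sdiff hinter,
          add_sub_cancel_right]
    _ ≤ ∑ p ∈ (A' ×ˢ B') \ (A ×ˢ B), |f p.1 p.2| :=
        (abs_sum_le_sum_abs _ _).trans
          (sum_le_sum_of_subset_of_nonneg hsub fun _ _ _ => abs_nonneg _)
    _ ≤ #((A' ×ˢ B') \ (A ×ˢ B)) := by
        simpa using sum_le_card_nsmul ((A' ×ˢ B') \ (A ×ˢ B)) (fun p => |f p.1 p.2|) 1
          fun p _ => hf p.1 p.2
    _ = (#A' * #B' - #A * #B : ℝ) := by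
        rw [eq_sub_iff_add_eq]
        exact_mod_cast hcard

lemma abs_rectSum_le_mul_card (hf : ∀ x y, |f x y| ≤ 1) (A : Finset α) (B : Finset β) :
    |rectSum f A B| ≤ #A * #B := by
  classical
  simpa [rectSum] using abs_rectSum_sub_rectSum_inter_le hf Subset.rfl Subset.rfl
    (empty_subset A) (empty_subset B)

lemma cutNorm_le_mul_card (hf : ∀ x y, |f x y| ≤ 1) (A : Finset α) (B : Finset β) :
    cutNorm f A B ≤ #A * #B :=
  cutNorm_le fun U hU W hW => (abs_rectSum_le_mul_card hf U W).trans (by gcongr)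

variable {A' : Finset α} {B' : Finset β}

lemma augCutNorm_le_add (hf : ∀ x y, |f x y| ≤ 1) (hA : A ⊆ A') (hB : B ⊆ B') :
    augCutNorm f A' B' ≤ augCutNorm f A B + 2 * (#A' * #B' - #A * #B : ℝ) := by
  classical
  have hrect : ∀ U ⊆ A', ∀ W ⊆ B',
      |rectSum f U W| ≤ |rectSum f (U ∩ A) (W ∩ B)| + (#A' * #B' - #A * #B : ℝ) :=
    fun U hU W hW => sub_le_iff_le_add'.1 ((abs_sub_abs_le_abs_sub _ _).trans
      (abs_rectSum_sub_rectSum_inter_le hf hU hW hA hB))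
  have hcut : cutNorm f A' B' ≤ cutNorm f A B + (#A' * #B' - #A * #B : ℝ) :=
    cutNorm_le fun U hU W hW => (hrect U hU W hW).trans
      (by gcongr; exact abs_rectSum_le_cutNorm inter_subset_right inter_subset_right)
  have htotal := hrect A' Subset.rfl B' Subset.rfl
  rw [inter_eq_right.2 hA, inter_eq_right.2 hB] at htotal
  unfold augCutNorm
  linarith

lemma augCutNorm_le_add_of_subset (hf : ∀ x y, |f x y| ≤ 1) (hA : A ⊆ A') (hB : B ⊆ B') :
    augCutNorm f A B ≤ augCutNorm f A' B' + (#A' * #B' - #A * #B : ℝ) := by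
  classical
  have htotal := abs_rectSum_sub_rectSum_inter_le hf Subset.rfl Subset.rfl hA hB
  rw [inter_eq_right.2 hA, inter_eq_right.2 hB, abs_sub_comm] at htotal
  have hcut := cutNorm_mono (f := f) hA hB
  have habs := abs_sub_abs_le_abs_sub (rectSum f A B) (rectSum f A' B')
  unfold augCutNorm
  linarith

lemma augCutNorm_le_two_mul_card (hf : ∀ x y, |f x y| ≤ 1) (A : Finset α) (B : Finset β) :
    augCutNorm f A B ≤ 2 * (#A * #B) := by
  rw [two_mul]
  exact add_le_add (cutNorm_le_mul_card hf A B) (abs_rectSum_le_mul_card hf A B)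

/-- The largest value of `∑ y ∈ B, φ (± ∑ x ∈ U, f x y)` over both signs and all `U ∈ 𝒰`. Both
terms of `augCutNorm` have this form, and as a supremum of sums over `y ∈ B` it is accessible to
symmetrization in the variable `y`. -/
def signedSup (φ : ℝ → ℝ) (𝒰 : Finset (Finset α)) (f : α → β → ℝ) (B : Finset β) : ℝ :=
  ⨆ τ : Bool × 𝒰, ∑ y ∈ B, φ (sgn τ.1 * ∑ x ∈ τ.2.1, f x y)

lemma le_signedSup (φ : ℝ → ℝ) {𝒰 : Finset (Finset α)} {U : Finset α} (hU : U ∈ 𝒰)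
    (f : α → β → ℝ) (B : Finset β) (s : Bool) :
    ∑ y ∈ B, φ (sgn s * ∑ x ∈ U, f x y) ≤ signedSup φ 𝒰 f B :=
  Finite.le_ciSup (fun τ : Bool × 𝒰 => ∑ y ∈ B, φ (sgn τ.1 * ∑ x ∈ τ.2.1, f x y)) (s, ⟨U, hU⟩)

lemma signedSup_le {φ : ℝ → ℝ} {𝒰 : Finset (Finset α)} (h𝒰 : 𝒰.Nonempty) {c : ℝ}
    (h : ∀ s, ∀ U ∈ 𝒰, ∑ y ∈ B, φ (sgn s * ∑ x ∈ U, f x y) ≤ c) : signedSup φ 𝒰 f B ≤ c := by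
  have := h𝒰.to_subtype
  exact ciSup_le fun τ => h τ.1 τ.2 τ.2.2

variable (f A B)

lemma mul_rectSum (c : ℝ) : c * rectSum f A B = ∑ y ∈ B, c * ∑ x ∈ A, f x y := by
  rw [rectSum, sum_comm, mul_sum]

lemma abs_rectSum_eq_signedSup : |rectSum f A B| = signedSup id {A} f B := by
  refine le_antisymm ?_ (signedSup_le (singleton_nonempty A) fun s U hU => ?_)
  · have hle : ∀ s, sgn s * rectSum f A B ≤ signedSup id {A} f B := fun s =>
      (mul_rectSum f A B _).trans_le (le_signedSup id (mem_singleton_self A) f B s)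
    exact abs_le'.2 ⟨by simpa [sgn] using hle true, by simpa [sgn] using hle false⟩
  · rw [mem_singleton.1 hU]
    exact (mul_rectSum f A B _).symm.trans_le (sgn_mul_le_abs _ _)

lemma cutNorm_eq_signedSup : cutNorm f A B = signedSup (·⁺) A.powerset f B := by
  refine le_antisymm (cutNorm_le fun U hU W hW => ?_)
    (signedSup_le (powerset_nonempty A) fun s U hU => ?_)
  · have hle : ∀ s, sgn s * rectSum f U W ≤ signedSup (·⁺) A.powerset f B := fun s =>
      calc sgn s * rectSum f U W
          = ∑ y ∈ W, sgn s * ∑ x ∈ U, f x y := mul_rectSum f U W _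
        _ ≤ ∑ y ∈ B, (sgn s * ∑ x ∈ U, f x y)⁺ :=
            (sum_le_sum fun y _ => le_posPart _).trans
              (sum_le_sum_of_subset_of_nonneg hW fun _ _ _ => posPart_nonneg _)
        _ ≤ signedSup (·⁺) A.powerset f B := le_signedSup _ (mem_powerset.2 hU) f B s
    exact abs_le'.2 ⟨by simpa [sgn] using hle true, by simpa [sgn] using hle false⟩
  · -- The supremum over `W` is attained where the signed column sums are positive.
    calc ∑ y ∈ B, (sgn s * ∑ x ∈ U, f x y)⁺
        = ∑ y ∈ B with 0 < sgn s * ∑ x ∈ U, f x y, sgn s * ∑ x ∈ U, f x y := by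
          rw [sum_filter]
          refine sum_congr rfl fun y _ => ?_
          split_ifs with hpos
          · exact posPart_of_nonneg hpos.le
          · exact posPart_of_nonpos (not_lt.1 hpos)
      _ = sgn s * rectSum f U {y ∈ B | 0 < sgn s * ∑ x ∈ U, f x y} := (mul_rectSum f U _ _).symm
      _ ≤ cutNorm f A B :=
          (sgn_mul_le_abs _ _).trans
            (abs_rectSum_le_cutNorm (mem_powerset.1 hU) (filter_subset _ _))

end CutNorm

section Sampling

variable {α V ι : Type*} {t : ℕ} (e : Fin t × ι ↪ V)

/-- One vertex from each row of the grid `e`, the one in row `r` being in column `z r`. -/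
def transversal (z : Fin t → ι) : Finset V :=
  univ.map ⟨fun r => e (r, z r), fun _ _ h => congrArg Prod.fst (e.injective h)⟩

/-- The vertices of the grid `e` in the columns with index in `S`. -/
def columns (S : Finset ι) : Finset V := (univ ×ˢ S).map e

lemma transversal_const (p : ι) : transversal e (fun _ => p) = columns e {p} := by
  ext v
  simp only [transversal, columns, mem_map, mem_product, mem_univ, mem_singleton, true_and,
    Prod.exists, exists_eq_left]
  rfl

lemma card_columns (S : Finset ι) : #(columns e S) = t * #S := by simp [columns]

lemma columns_subset_columns {S S' : Finset ι} (h : S ⊆ S') : columns e S ⊆ columns e S' :=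
  map_subset_map.2 (product_subset_product_right h)

lemma sum_transversal (z : Fin t → ι) (F : V → ℝ) :
    ∑ y ∈ transversal e z, F y = ∑ r, F (e (r, z r)) :=
  sum_map _ _ _

lemma sum_columns (S : Finset ι) (F : V → ℝ) :
    ∑ y ∈ columns e S, F y = #S * ∑ r, 𝔼 a : S, F (e (r, a)) := by
  rw [columns, sum_map, sum_product, mul_sum]
  refine sum_congr rfl fun r _ => ?_
  rw [← Fintype.card_coe, Fintype.card_mul_expect, sum_coe_sort S fun a => F (e (r, a))]

lemma expect_ciSup_sum_sgn_mul_le {Ω : Type*} [Fintype Ω] [Nonempty Ω] {g : α → Fin t → Ω → ℝ}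
    (hg : ∀ x r a, |g x r a| ≤ 1) {A : Finset α} {𝒰 : Finset (Finset α)} (h𝒰 : 𝒰.Nonempty)
    (h𝒰A : 𝒰 ⊆ A.powerset) :
    𝔼 w : Fin t → Ω × Bool, ⨆ τ : Bool × 𝒰,
      2 * ∑ r, sgn (w r).2 * (sgn τ.1 * ∑ x ∈ τ.2.1, g x r (w r).1) ≤ 2 * (#A * √t) := by
  have := h𝒰.to_subtype
  calc _ ≤ 𝔼 w : Fin t → Ω × Bool, 2 * ∑ x ∈ A, |∑ r, sgn (w r).2 * g x r (w r).1| := by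
        refine expect_le_expect fun w _ => ciSup_le fun τ => ?_
        gcongr
        calc ∑ r, sgn (w r).2 * (sgn τ.1 * ∑ x ∈ τ.2.1, g x r (w r).1)
            = sgn τ.1 * ∑ x ∈ τ.2.1, ∑ r, sgn (w r).2 * g x r (w r).1 := by
              rw [sum_comm, mul_sum]
              exact sum_congr rfl fun r _ => by rw [← mul_sum, mul_left_comm]
          _ ≤ ∑ x ∈ τ.2.1, |∑ r, sgn (w r).2 * g x r (w r).1| :=
              (sgn_mul_le_abs _ _).trans (abs_sum_le_sum_abs _ _)
          _ ≤ ∑ x ∈ A, |∑ r, sgn (w r).2 * g x r (w r).1| :=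
              sum_le_sum_of_subset_of_nonneg (mem_powerset.1 (h𝒰A τ.2.2)) fun _ _ _ => abs_nonneg _
    _ = 2 * ∑ x ∈ A, 𝔼 w : Fin t → Ω × Bool, |∑ r, sgn (w r).2 * g x r (w r).1| := by
        rw [← mul_expect, expect_sum_comm]
    _ ≤ 2 * (#A * √t) := by
        gcongr
        rw [← nsmul_eq_mul]
        refine sum_le_card_nsmul _ _ _ fun x _ => ?_
        exact (expect_abs_sum_sgn_mul_le zero_le_one (hg x)).trans_eq (one_mul _)

variable {f : α → V → ℝ} {S : Finset ι}

lemma expect_signedSup_transversal_le {φ : ℝ → ℝ} (hφ : LipschitzWith 1 φ)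
    (hf : ∀ x y, |f x y| ≤ 1) {A : Finset α} {𝒰 : Finset (Finset α)} (h𝒰 : 𝒰.Nonempty)
    (h𝒰A : 𝒰 ⊆ A.powerset) (hS : S.Nonempty) :
    𝔼 z : Fin t → S, signedSup φ 𝒰 f (transversal e fun r => z r) ≤
      signedSup φ 𝒰 f (columns e S) / #S + 2 * (#A * √t) := by
  have := hS.to_subtype
  have := h𝒰.to_subtype
  have hlip : ∀ r (a : S) (τ τ' : Bool × 𝒰),
      |φ (sgn τ.1 * ∑ x ∈ τ.2.1, f x (e (r, a))) - φ (sgn τ'.1 * ∑ x ∈ τ'.2.1, f x (e (r, a)))| ≤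
        |sgn τ.1 * ∑ x ∈ τ.2.1, f x (e (r, a)) - sgn τ'.1 * ∑ x ∈ τ'.2.1, f x (e (r, a))| :=
    fun r a τ τ' => by simpa [Real.dist_eq] using hφ.dist_le_mul _ _
  have hmean : (⨆ τ : Bool × 𝒰, ∑ r, 𝔼 a : S, φ (sgn τ.1 * ∑ x ∈ τ.2.1, f x (e (r, a)))) ≤
      signedSup φ 𝒰 f (columns e S) / #S := ciSup_le fun τ => by
    rw [le_div_iff₀' (by exact_mod_cast hS.card_pos),
      ← sum_columns e S fun y => φ (sgn τ.1 * ∑ x ∈ τ.2.1, f x y)]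
    exact le_signedSup φ τ.2.2 f _ _
  have hnoise := expect_ciSup_sum_sgn_mul_le (fun x r (a : S) => hf x (e (r, a))) h𝒰 h𝒰A
  simpa only [signedSup, sum_transversal] using
    (expect_ciSup_sum_le hlip).trans (add_le_add hmean hnoise)

lemma expect_augCutNorm_transversal_le (hf : ∀ x y, |f x y| ≤ 1) (A : Finset α)
    (hS : S.Nonempty) :
    𝔼 z : Fin t → S, augCutNorm f A (transversal e fun r => z r) ≤
      augCutNorm f A (columns e S) / #S + 4 * (#A * √t) := by
  have hcut := expect_signedSup_transversal_le e lipschitzWith_posPart hf (powerset_nonempty A)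
    Subset.rfl hS
  have htotal := expect_signedSup_transversal_le e LipschitzWith.id hf (singleton_nonempty A)
    (singleton_subset_iff.2 (mem_powerset_self A)) hS
  simp only [← cutNorm_eq_signedSup, ← abs_rectSum_eq_signedSup] at hcut htotal
  simp only [augCutNorm, expect_add_distrib, add_div]
  linarith

end Sampling

section Rearrangement

variable {ι κ : Type*}

/-- The permutations that preserve the fibres of `cl`. Random elements of this group rearrange the
rows of a grid without moving a column out of its part. -/
def fiberPerm (cl : ι → κ) : Subgroup (Equiv.Perm ι) where
  carrier := {σ | ∀ a, cl (σ a) = cl a}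
  mul_mem' {σ τ} hσ hτ a := (hσ (τ a)).trans (hτ a)
  one_mem' _ := rfl
  inv_mem' {σ} hσ a := by simpa using (hσ (σ⁻¹ a)).symm

instance [Finite ι] (cl : ι → κ) : Fintype (fiberPerm cl) := Fintype.ofFinite _

lemma swap_mem_fiberPerm [DecidableEq ι] {cl : ι → κ} {a b : ι} (h : cl a = cl b) :
    Equiv.swap a b ∈ fiberPerm cl := fun c => by
  rw [Equiv.swap_apply_def]
  split_ifs with ha hb
  · rw [ha, h]
  · rw [hb, h]
  · rfl

lemma expect_eq_expect_expect_mul {H Ω : Type*} [Group H] [Fintype H] [Fintype Ω] [Nonempty Ω]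
    (σ : Ω → H) (F : H → ℝ) : 𝔼 ω, F ω = 𝔼 ω, 𝔼 z, F (ω * σ z) := by
  rw [expect_comm, ← Fintype.expect_const (ι := Ω) (𝔼 ω, F ω)]
  exact expect_congr rfl fun z _ =>
    (Fintype.expect_equiv (Equiv.mulRight (σ z)) _ _ fun _ => rfl).symm

variable {α V : Type*} {t : ℕ} (e : Fin t × ι ↪ V) {cl : ι → κ}

/-- The grid `e` with row `r` rearranged by `ω r`. -/
def permuteRows (ω : Fin t → fiberPerm cl) : Fin t × ι ↪ V :=
  (Equiv.prodCongrRight fun r => (ω r : Equiv.Perm ι)).toEmbedding.trans e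

lemma permuteRows_apply (ω : Fin t → fiberPerm cl) (r : Fin t) (a : ι) :
    permuteRows e ω (r, a) = e (r, (ω r : Equiv.Perm ι) a) := rfl

lemma columns_permuteRows_mul_swap [DecidableEq ι] (ω : Fin t → fiberPerm cl) (q : ι)
    {z : Fin t → ι} (hz : ∀ r, cl q = cl (z r)) :
    columns (permuteRows e (ω * fun r => ⟨Equiv.swap q (z r), swap_mem_fiberPerm (hz r)⟩)) {q} =
      transversal (permuteRows e ω) z := by
  rw [← transversal_const]
  simp [transversal, permuteRows_apply]

lemma columns_permuteRows_mul_of_fixed (ω : Fin t → fiberPerm cl) {σ : Fin t → fiberPerm cl}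
    {p : ι} (hσ : ∀ r, (σ r : Equiv.Perm ι) p = p) :
    columns (permuteRows e (ω * σ)) {p} = columns (permuteRows e ω) {p} := by
  simp [← transversal_const, transversal, permuteRows_apply, hσ]

lemma sum_expect_augCutNorm_column_le [Finite ι] {f : α → V → ℝ} (hf : ∀ x y, |f x y| ≤ 1)
    {S : Finset ι} {y : κ} (hS : ∀ q ∈ S, cl q = y) {A : (Fin t → fiberPerm cl) → Finset α} {c : ℝ}
    (hAc : ∀ ω, #(A ω) ≤ c)
    (hA : ∀ ω σ, (∀ r, ∀ a ∉ S, (σ r : Equiv.Perm ι) a = a) → A (ω * σ) = A ω) :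
    ∑ q ∈ S, 𝔼 ω, augCutNorm f (A ω) (columns (permuteRows e ω) {q}) ≤
      𝔼 ω, augCutNorm f (A ω) (columns (permuteRows e ω) S) + #S * (4 * (c * √t)) := by
  classical
  rcases S.eq_empty_or_nonempty with rfl | hne
  · simpa using expect_nonneg fun ω _ => augCutNorm_nonneg
  have := hne.to_subtype
  have hcolumn : ∀ q ∈ S, 𝔼 ω, augCutNorm f (A ω) (columns (permuteRows e ω) {q}) ≤
      (𝔼 ω, augCutNorm f (A ω) (columns (permuteRows e ω) S)) / #S + 4 * (c * √t) := fun q hq => by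
    -- Composing row `r` with the transposition of `q` and a random `z r ∈ S` moves the column `q`
    -- to a random transversal of the columns `S`, but fixes `A ω`.
    have hcl : ∀ a : S, cl q = cl a := fun a => (hS q hq).trans (hS a a.2).symm
    let σ (z : Fin t → S) (r : Fin t) : fiberPerm cl :=
      ⟨Equiv.swap q (z r), swap_mem_fiberPerm (hcl (z r))⟩
    have hAσ : ∀ ω z, A (ω * σ z) = A ω := fun ω z => hA ω _ fun r a ha =>
      Equiv.swap_apply_of_ne_of_ne (ne_of_mem_of_not_mem hq ha).symm
        (ne_of_mem_of_not_mem (z r).2 ha).symm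
    calc 𝔼 ω, augCutNorm f (A ω) (columns (permuteRows e ω) {q})
        = 𝔼 ω, 𝔼 z : Fin t → S,
            augCutNorm f (A ω) (transversal (permuteRows e ω) fun r => z r) := by
          rw [expect_eq_expect_expect_mul σ]
          refine expect_congr rfl fun ω _ => expect_congr rfl fun z _ => ?_
          rw [hAσ, columns_permuteRows_mul_swap e ω q fun r => hcl (z r)]
      _ ≤ 𝔼 ω, (augCutNorm f (A ω) (columns (permuteRows e ω) S) / #S + 4 * (c * √t)) := by
          refine expect_le_expect fun ω _ =>
            (expect_augCutNorm_transversal_le _ hf (A ω) hne).trans ?_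
          gcongr
          exact hAc ω
      _ = _ := by rw [expect_add_distrib, Fintype.expect_const, expect_div]
  calc _ ≤ ∑ q ∈ S, ((𝔼 ω, augCutNorm f (A ω) (columns (permuteRows e ω) S)) / #S +
          4 * (c * √t)) := sum_le_sum hcolumn
    _ = _ := by
        rw [sum_const, nsmul_eq_mul, mul_add, mul_div_cancel₀]
        exact_mod_cast hne.card_ne_zero

variable [Fintype ι] [DecidableEq κ]

lemma columns_permuteRows_fiber (ω : Fin t → fiberPerm cl) (y : κ) :
    columns (permuteRows e ω) {a | cl a = y} = columns e {a | cl a = y} := by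
  refine eq_of_subset_of_card_le (fun v hv => ?_) (by simp [card_columns])
  obtain ⟨⟨r, a⟩, ha, rfl⟩ := mem_map.1 hv
  refine mem_map.2 ⟨(r, (ω r : Equiv.Perm ι) a), ?_, rfl⟩
  simpa [(ω r).2 a] using ha

lemma sum_expect_augCutNorm_column_left_le {f : V → α → ℝ} (hf : ∀ x y, |f x y| ≤ 1) (x : κ)
    (B : Finset α) :
    ∑ p with cl p = x, 𝔼 ω : Fin t → fiberPerm cl, augCutNorm f (columns (permuteRows e ω) {p}) B ≤
      augCutNorm f (columns e {a | cl a = x}) B + #{a | cl a = x} * (4 * (#B * √t)) := by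
  have h := sum_expect_augCutNorm_column_le e (f := Function.swap f) (fun x y => hf y x)
    (fun p (hp : p ∈ ({a | cl a = x} : Finset ι)) => (mem_filter.1 hp).2)
    (fun _ : Fin t → fiberPerm cl => le_refl (#B : ℝ)) fun _ _ _ => rfl
  simpa only [augCutNorm_swap, columns_permuteRows_fiber, Fintype.expect_const] using h

lemma expect_augCutNorm_columns_erase_le [DecidableEq ι] {f : α → V → ℝ}
    (hf : ∀ x y, |f x y| ≤ 1) {p : ι} {y : κ} (hp : cl p = y)
    {A : (Fin t → fiberPerm cl) → Finset α} {c : ℝ} (hAc : ∀ ω, #(A ω) ≤ c) :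
    𝔼 ω, augCutNorm f (A ω) (columns (permuteRows e ω) (({a | cl a = y} : Finset ι).erase p)) ≤
      𝔼 ω, augCutNorm f (A ω) (columns e {a | cl a = y}) + c * t := by
  rw [← Fintype.expect_const (ι := Fin t → fiberPerm cl) (c * t), ← expect_add_distrib]
  refine expect_le_expect fun ω _ => ?_
  have hle := augCutNorm_le_add_of_subset hf (Subset.refl (A ω))
    (columns_subset_columns (permuteRows e ω) (erase_subset p {a | cl a = y}))
  have hcard : (#(({a | cl a = y} : Finset ι).erase p) : ℝ) + 1 = #{a | cl a = y} :=
    mod_cast card_erase_add_one (mem_filter.2 ⟨mem_univ p, hp⟩)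
  have hAt := mul_le_mul_of_nonneg_right (hAc ω) (Nat.cast_nonneg (α := ℝ) t)
  rw [columns_permuteRows_fiber, card_columns, card_columns] at hle
  push_cast at hle
  rw [← hcard] at hle
  linarith

lemma sum_expect_augCutNorm_column_column_le {f : V → V → ℝ} (hf : ∀ x y, |f x y| ≤ 1) (p : ι)
    (y : κ) :
    ∑ q with cl q = y, 𝔼 ω : Fin t → fiberPerm cl,
      augCutNorm f (columns (permuteRows e ω) {p}) (columns (permuteRows e ω) {q}) ≤
      𝔼 ω : Fin t → fiberPerm cl,
        augCutNorm f (columns (permuteRows e ω) {p}) (columns e {a | cl a = y}) +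
      (if cl p = y then 3 * (t : ℝ) ^ 2 else 0) + #{a | cl a = y} * (4 * (t * √t)) := by
  classical
  set F : Finset ι := {a | cl a = y} with hF
  have hoff := sum_expect_augCutNorm_column_le e hf (S := F.erase p)
    (fun q hq => (mem_filter.1 (mem_of_mem_erase hq)).2)
    (A := fun ω : Fin t → fiberPerm cl => columns (permuteRows e ω) {p}) (c := t)
    (fun ω => by simp [card_columns])
    (fun ω σ hσ => columns_permuteRows_mul_of_fixed e ω fun r => hσ r p (notMem_erase p F))
  by_cases hp : cl p = y
  · have hpF : p ∈ F := by simpa [hF] using hp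
    have hdiag : 𝔼 ω : Fin t → fiberPerm cl,
        augCutNorm f (columns (permuteRows e ω) {p}) (columns (permuteRows e ω) {p}) ≤
          2 * (t : ℝ) ^ 2 := expect_le univ_nonempty fun ω _ => by
      simpa [card_columns, sq] using augCutNorm_le_two_mul_card hf
        (columns (permuteRows e ω) {p}) (columns (permuteRows e ω) {p})
    have hcard : (#F : ℝ) = #(F.erase p) + 1 := by exact_mod_cast (card_erase_add_one hpF).symm
    have herase := expect_augCutNorm_columns_erase_le e hf hp
      (A := fun ω : Fin t → fiberPerm cl => columns (permuteRows e ω) {p}) (c := t)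
      fun ω => by simp [card_columns]
    rw [← hF] at herase
    have hT : (0 : ℝ) ≤ t * √t := by positivity
    rw [if_pos hp, ← add_sum_erase _ _ hpF, hcard]
    linarith
  · rw [erase_eq_of_notMem (by simpa [hF] using hp)] at hoff
    simpa only [hF, columns_permuteRows_fiber, if_neg hp, add_zero] using hoff

variable [Fintype κ]

lemma sum_comp_fiber (cl : ι → κ) (h : κ → ι → ℝ) :
    ∑ q, h (cl q) q = ∑ y, ∑ q with cl q = y, h y q := by
  rw [← sum_fiberwise univ cl]
  exact sum_congr rfl fun y _ => sum_congr rfl fun q hq => by rw [(mem_filter.1 hq).2]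

lemma sum_card_fiber (cl : ι → κ) : ∑ y, (#{a | cl a = y} : ℝ) = Fintype.card ι := by
  rw [← card_univ, card_eq_sum_card_fiberwise fun p _ => mem_univ (cl p), Nat.cast_sum]

lemma sum_expect_augCutNorm_le_sum_fiber_right {f : κ → V → V → ℝ} (hf : ∀ y u v, |f y u v| ≤ 1)
    (p : ι) :
    ∑ q, 𝔼 ω : Fin t → fiberPerm cl,
      augCutNorm (f (cl q)) (columns (permuteRows e ω) {p}) (columns (permuteRows e ω) {q}) ≤
      ∑ y, 𝔼 ω : Fin t → fiberPerm cl,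
        augCutNorm (f y) (columns (permuteRows e ω) {p}) (columns e {a | cl a = y}) +
      (3 * (t : ℝ) ^ 2 + Fintype.card ι * (4 * (t * √t))) := by
  rw [sum_comp_fiber cl fun y q => 𝔼 ω : Fin t → fiberPerm cl,
    augCutNorm (f y) (columns (permuteRows e ω) {p}) (columns (permuteRows e ω) {q})]
  refine (sum_le_sum fun y _ => sum_expect_augCutNorm_column_column_le e (hf y) p y).trans_eq ?_
  rw [sum_add_distrib, sum_add_distrib, sum_ite_eq, if_pos (mem_univ _), ← sum_mul,
    sum_card_fiber, add_assoc]

lemma sum_expect_augCutNorm_le_sum_fiber_left {f : κ → κ → V → V → ℝ}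
    (hf : ∀ x y u v, |f x y u v| ≤ 1) :
    ∑ p, ∑ y, 𝔼 ω : Fin t → fiberPerm cl,
      augCutNorm (f (cl p) y) (columns (permuteRows e ω) {p}) (columns e {a | cl a = y}) ≤
      ∑ x, ∑ y, augCutNorm (f x y) (columns e {a | cl a = x}) (columns e {a | cl a = y}) +
      4 * (Fintype.card ι : ℝ) ^ 2 * (t * √t) := by
  rw [sum_comp_fiber cl fun x p => ∑ y, 𝔼 ω : Fin t → fiberPerm cl,
    augCutNorm (f x y) (columns (permuteRows e ω) {p}) (columns e {a | cl a = y})]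
  calc _ ≤ ∑ x, ∑ y, (augCutNorm (f x y) (columns e {a | cl a = x}) (columns e {a | cl a = y}) +
          #{a | cl a = x} * (4 * (#(columns e {a | cl a = y}) * √t))) := by
        refine sum_le_sum fun x _ => ?_
        rw [sum_comm]
        exact sum_le_sum fun y _ => sum_expect_augCutNorm_column_left_le e (hf x y) x _
    _ = ∑ x, ∑ y, augCutNorm (f x y) (columns e {a | cl a = x}) (columns e {a | cl a = y}) +
          (∑ x, (#{a | cl a = x} : ℝ)) * (∑ y, (#{a | cl a = y} : ℝ)) * (4 * (t * √t)) := by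
        simp only [sum_add_distrib, card_columns]
        rw [sum_mul_sum]
        simp only [sum_mul]
        push_cast
        congr 1
        exact sum_congr rfl fun x _ => sum_congr rfl fun y _ => by ring
    _ = _ := by
        rw [sum_card_fiber]
        ring

lemma exists_sum_augCutNorm_column_le (cl : ι → κ) {f : κ → κ → V → V → ℝ}
    (hf : ∀ x y u v, |f x y u v| ≤ 1) :
    ∃ e' : Fin t × ι ↪ V,
      ∑ p, ∑ q, augCutNorm (f (cl p) (cl q)) (columns e' {p}) (columns e' {q}) ≤
        ∑ x, ∑ y, augCutNorm (f x y) (columns e {a | cl a = x}) (columns e {a | cl a = y}) +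
          3 * Fintype.card ι * (t : ℝ) ^ 2 + 8 * (Fintype.card ι : ℝ) ^ 2 * (t * √t) := by
  have hmean : 𝔼 ω : Fin t → fiberPerm cl, ∑ p, ∑ q, augCutNorm (f (cl p) (cl q))
      (columns (permuteRows e ω) {p}) (columns (permuteRows e ω) {q}) ≤
        ∑ x, ∑ y, augCutNorm (f x y) (columns e {a | cl a = x}) (columns e {a | cl a = y}) +
          3 * Fintype.card ι * (t : ℝ) ^ 2 + 8 * (Fintype.card ι : ℝ) ^ 2 * (t * √t) := by
    simp only [expect_sum_comm]
    have hright := sum_le_sum fun p (_ : p ∈ univ) =>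
      sum_expect_augCutNorm_le_sum_fiber_right e (cl := cl) (hf (cl p)) p
    have hleft := sum_expect_augCutNorm_le_sum_fiber_left e (cl := cl) hf
    rw [sum_add_distrib, sum_const, card_univ, nsmul_eq_mul] at hright
    linarith
  obtain ⟨ω, -, hω⟩ := exists_le_of_expect_le univ_nonempty hmean
  exact ⟨permuteRows e ω, hω⟩

end Rearrangement

section Equipartition

variable {V : Type*} {t : ℕ}

lemma exists_grid [DecidableEq V] {s : Finset V} (P : Finpartition s) (ht : 0 < t) :
    ∃ (K : ℕ) (cl : Fin K → P.parts) (e : Fin t × Fin K ↪ V),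
      (∀ r p, e (r, p) ∈ (cl p).1) ∧ #s ≤ K * t + #P.parts * t := by
  let ι := Σ X : P.parts, Fin (#X.1 / t)
  have hemb (X : P.parts) : Nonempty (Fin t × Fin (#X.1 / t) ↪ X.1) :=
    Function.Embedding.nonempty_of_card_le (by simpa using Nat.mul_div_le _ _)
  let φ (X : P.parts) := (hemb X).some
  let e : Fin t × ι → V := fun x => φ x.2.1 (x.1, x.2.2)
  have he : Function.Injective e := by
    rintro ⟨r, X, i⟩ ⟨r', X', i'⟩ (h : (φ X (r, i) : V) = φ X' (r', i'))
    obtain rfl : X = X' := Subtype.ext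
      (P.disjoint.elim_finset X.2 X'.2 _ (φ X (r, i)).2 (h ▸ (φ X' (r', i')).2))
    obtain ⟨rfl, rfl⟩ := Prod.mk.inj ((φ X).injective (Subtype.ext h))
    rfl
  let ψ := (Fintype.equivFin ι).symm
  refine ⟨Fintype.card ι, fun p => (ψ p).1,
    ((Equiv.refl _).prodCongr ψ).toEmbedding.trans ⟨e, he⟩, fun r p => (φ _ _).2, ?_⟩
  have hcard : Fintype.card ι = ∑ X ∈ P.parts, #X / t := by
    rw [Fintype.card_sigma, ← sum_coe_sort P.parts fun X => #X / t]
    simp only [Fintype.card_fin]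
  rw [hcard, ← P.sum_card_parts, card_eq_sum_ones, sum_mul, sum_mul, ← sum_add_distrib]
  refine sum_le_sum fun X _ => ?_
  rw [← add_mul]
  exact (Nat.lt_mul_of_div_lt (Nat.lt_succ_self _) ht).le

variable [Fintype V] {K : ℕ}

lemma exists_balanced_coloring (hK : 0 < K) (e : Fin t × Fin K ↪ V) :
    ∃ χ : V → Fin K, (∀ r p, χ (e (r, p)) = p) ∧
      ∃ c, ∀ p, #{v | χ v = p} = c ∨ #{v | χ v = p} = c + 1 := by
  let ψ : V → ℕ := Function.extend e (fun x => (finProdFinEquiv x : ℕ)) 0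
  have hψ (x) : ψ (e x) = finProdFinEquiv x := e.injective.extend_apply _ _ _
  have hcard : t * K ≤ Fintype.card V := by simpa using Fintype.card_le_of_embedding e
  obtain ⟨g, hg⟩ := Finset.exists_equiv_extend_of_card_eq (card_range (Fintype.card V)).symm
    (s := univ.map e) (f := ψ) (by
      intro j hj
      simp only [mem_image, mem_map, mem_univ, true_and, exists_exists_eq_and, hψ] at hj
      obtain ⟨x, rfl⟩ := hj
      exact mem_range.2 ((finProdFinEquiv x).2.trans_le hcard))
    (by
      simp only [coe_map, coe_univ, Set.image_univ]
      rintro _ ⟨x, rfl⟩ _ ⟨y, rfl⟩ h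
      rw [hψ, hψ] at h
      rw [finProdFinEquiv.injective (Fin.ext h)])
  refine ⟨fun v => ⟨g v % K, Nat.mod_lt _ hK⟩, fun r p => ?_, Fintype.card V / K, fun p => ?_⟩
  · ext
    simp [hg, hψ, Nat.mod_eq_of_lt p.2]
  · have hcount : #{v | (⟨g v % K, Nat.mod_lt _ hK⟩ : Fin K) = p} =
        Nat.count (· ≡ p [MOD K]) (Fintype.card V) := by
      have hmod (j : ℕ) : (⟨j % K, Nat.mod_lt _ hK⟩ : Fin K) = p ↔ j ≡ p [MOD K] := by
        rw [Fin.ext_iff, Nat.ModEq, Nat.mod_eq_of_lt p.2]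
      rw [Nat.count_eq_card_filter_range]
      refine card_bij (fun v _ => (g v : ℕ)) (fun v hv => ?_)
        (fun _ _ _ _ h => g.injective (Subtype.ext h)) fun j hj => ?_
      · exact mem_filter.2 ⟨(g v).2, (hmod _).1 (mem_filter.1 hv).2⟩
      · obtain ⟨hj, hjp⟩ := mem_filter.1 hj
        exact ⟨g.symm ⟨j, hj⟩, by simpa [hmod] using hjp, by simp⟩
    rw [hcount, Nat.count_modEq_card _ hK]
    split_ifs <;> simp

lemma exists_equipartition_columns_subset [DecidableEq V] (ht : 0 < t) (hK : 0 < K)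
    (e : Fin t × Fin K ↪ V) :
    ∃ (Q : Finpartition (univ : Finset V)) (B : Fin K ↪ Finset V),
      Q.IsEquipartition ∧ Q.parts = univ.map B ∧ ∀ p, columns e {p} ⊆ B p := by
  obtain ⟨χ, hχ, c, hc⟩ := exists_balanced_coloring hK e
  let C (p : Fin K) : Finset V := {v | χ v = p}
  have hC (v p) : v ∈ C p ↔ χ v = p := by simp [C]
  have hmem (r p) : e (r, p) ∈ C p := (hC _ _).2 (hχ r p)
  let B : Fin K ↪ Finset V :=
    ⟨C, fun p q h => (hχ ⟨0, ht⟩ p).symm.trans ((hC _ q).1 (h ▸ hmem ⟨0, ht⟩ p))⟩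
  let Q : Finpartition (univ : Finset V) :=
    .ofExistsUnique (univ.map B) (fun _ _ => subset_univ _)
      (fun v _ => ⟨C (χ v), ⟨mem_map_of_mem B (mem_univ _), (hC v _).2 rfl⟩, by
        rintro _ ⟨hX, hv⟩
        obtain ⟨p, -, rfl⟩ := mem_map.1 hX
        exact congrArg C ((hC v p).1 hv).symm⟩) (by
        simp only [mem_map, mem_univ, true_and, not_exists]
        exact fun p => ne_of_mem_of_not_mem' (hmem ⟨0, ht⟩ p) (notMem_empty _))
  refine ⟨Q, B, Set.equitableOn_iff_exists_eq_eq_add_one.2 ⟨c, fun X hX => ?_⟩, rfl, ?_⟩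
  · obtain ⟨p, -, rfl⟩ := mem_map.1 (mem_coe.1 hX)
    exact hc p
  · intro p v hv
    simp only [columns, mem_map, mem_product, mem_univ, mem_singleton, true_and,
      Prod.exists] at hv
    obtain ⟨r, q, rfl, rfl⟩ := hv
    exact hmem r q

end Equipartition

section Irregularity

variable {V : Type} (G : SimpleGraph V) [DecidableRel G.Adj]

/-- The deviation of the adjacency function of `G` from the constant `c`. For `c` the density of a
pair of vertex sets, its cut norm on that pair is the irregularity of the pair. -/
def deviation (c : ℝ) (x y : V) : ℝ := (if G.Adj x y then 1 else 0) - c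

lemma abs_deviation_le_one {c : ℝ} (hc : c ∈ Set.Icc 0 1) (x y : V) : |deviation G c x y| ≤ 1 := by
  obtain ⟨h0, h1⟩ := hc
  rw [deviation, abs_le]
  split_ifs <;> constructor <;> linarith

lemma rectSum_deviation (c : ℝ) (U W : Finset V) :
    rectSum (deviation G c) U W = #(G.interedges U W) - #U * #W * c := by
  have hcount : (#(G.interedges U W) : ℝ) = ∑ x ∈ U, ∑ y ∈ W, if G.Adj x y then 1 else 0 := by
    rw [← sum_product', SimpleGraph.interedges, Rel.interedges, card_filter, Nat.cast_sum]
    simp only [Nat.cast_ite, Nat.cast_one, Nat.cast_zero]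
  simp only [rectSum, deviation, sum_sub_distrib, sum_const, nsmul_eq_mul, hcount]
  ring

lemma edgeDensity_mem_Icc (X Y : Finset V) : (G.edgeDensity X Y : ℝ) ∈ Set.Icc 0 1 :=
  ⟨mod_cast G.edgeDensity_nonneg X Y, mod_cast G.edgeDensity_le_one X Y⟩

lemma card_mul_edgeDensity (X Y : Finset V) :
    (#X : ℝ) * #Y * G.edgeDensity X Y = #(G.interedges X Y) := by
  rw [SimpleGraph.edgeDensity_def]
  push_cast
  refine mul_div_cancel_of_imp' fun h => ?_
  have hle : (#(G.interedges X Y) : ℝ) ≤ #X * #Y := mod_cast G.card_interedges_le_mul X Y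
  exact le_antisymm (hle.trans_eq h) (Nat.cast_nonneg _)

lemma rectSum_deviation_eq_mul_sub (c : ℝ) (X Y : Finset V) :
    rectSum (deviation G c) X Y = #X * #Y * (G.edgeDensity X Y - c) := by
  rw [rectSum_deviation, ← card_mul_edgeDensity, mul_sub]

lemma pairIrreg_eq_cutNorm (X Y : Finset V) :
    pairIrreg G X Y = cutNorm (deviation G (G.edgeDensity X Y)) X Y := by
  simp only [pairIrreg, cutNorm, rectSum_deviation]

lemma pairIrreg_eq_augCutNorm (X Y : Finset V) :
    pairIrreg G X Y = augCutNorm (deviation G (G.edgeDensity X Y)) X Y := by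
  rw [augCutNorm, rectSum_deviation_eq_mul_sub, sub_self, mul_zero, abs_zero, add_zero,
    pairIrreg_eq_cutNorm]

lemma pairIrreg_le_augCutNorm (c : ℝ) (X Y : Finset V) :
    pairIrreg G X Y ≤ augCutNorm (deviation G c) X Y := by
  rw [pairIrreg_eq_cutNorm]
  refine cutNorm_le fun U hU W hW => ?_
  have hsplit : rectSum (deviation G (G.edgeDensity X Y)) U W =
      rectSum (deviation G c) U W - #U * #W * (G.edgeDensity X Y - c) := by
    rw [rectSum_deviation, rectSum_deviation]
    ring
  have htotal : |(#U * #W * (G.edgeDensity X Y - c) : ℝ)| ≤ |rectSum (deviation G c) X Y| := by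
    rw [rectSum_deviation_eq_mul_sub, abs_mul, abs_mul (#X * #Y : ℝ), abs_of_nonneg (by positivity),
      abs_of_nonneg (a := (#X * #Y : ℝ)) (by positivity)]
    gcongr
  rw [hsplit]
  exact (abs_sub _ _).trans (add_le_add (abs_rectSum_le_cutNorm hU hW) htotal)

lemma pairIrreg_le_mul_card (X Y : Finset V) : pairIrreg G X Y ≤ #X * #Y := by
  rw [pairIrreg_eq_cutNorm]
  exact cutNorm_le_mul_card (abs_deviation_le_one G (edgeDensity_mem_Icc G X Y)) X Y

lemma pairIrreg_nonneg (X Y : Finset V) : 0 ≤ pairIrreg G X Y :=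
  pairIrreg_eq_augCutNorm G X Y ▸ augCutNorm_nonneg

lemma pairIrreg_singleton (x y : V) : pairIrreg G {x} {y} = 0 := by
  refine le_antisymm ?_ (pairIrreg_nonneg G _ _)
  rw [pairIrreg_eq_cutNorm]
  refine cutNorm_le fun U hU W hW => ?_
  rcases subset_singleton_iff.1 hU with rfl | rfl
  · simp [rectSum]
  rcases subset_singleton_iff.1 hW with rfl | rfl
  · simp [rectSum]
  rw [rectSum_deviation_eq_mul_sub, sub_self, mul_zero, abs_zero]

variable [Fintype V] [DecidableEq V]

lemma irreg_bot : irreg G (⊥ : Finpartition (univ : Finset V)) = 0 := by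
  simp [irreg, Finpartition.parts_bot, pairIrreg_singleton]

lemma irreg_nonneg (P : Finpartition (univ : Finset V)) : 0 ≤ irreg G P :=
  sum_nonneg fun X _ => sum_nonneg fun Y _ => pairIrreg_nonneg G X Y

lemma irreg_eq_sum_coe (P : Finpartition (univ : Finset V)) :
    irreg G P = ∑ X : P.parts, ∑ Y : P.parts, pairIrreg G X Y :=
  (sum_coe_sort _ _).symm.trans (sum_congr rfl fun X _ => (sum_coe_sort _ (pairIrreg G X)).symm)

variable {ι : Type*} [Fintype ι] {t : ℕ}

lemma irreg_le_sum_augCutNorm_columns {Q : Finpartition (univ : Finset V)} {B : ι ↪ Finset V}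
    (hQ : Q.parts = univ.map B) {e : Fin t × ι ↪ V} (he : ∀ p, columns e {p} ⊆ B p)
    {c : ι → ι → ℝ} (hc : ∀ p q, c p q ∈ Set.Icc 0 1) :
    irreg G Q ≤ ∑ p, ∑ q, augCutNorm (deviation G (c p q)) (columns e {p}) (columns e {q}) +
      2 * ((Fintype.card V : ℝ) ^ 2 - (Fintype.card ι * t) ^ 2) := by
  have hB : ∑ p, (#(B p) : ℝ) = Fintype.card V := by
    have hcard := Q.sum_card_parts
    rw [hQ, sum_map] at hcard
    exact_mod_cast hcard
  calc irreg G Q = ∑ p, ∑ q, pairIrreg G (B p) (B q) := by simp only [irreg, hQ, sum_map]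
    _ ≤ ∑ p, ∑ q, (augCutNorm (deviation G (c p q)) (columns e {p}) (columns e {q}) +
          2 * (#(B p) * #(B q) - t * t : ℝ)) := by
        refine sum_le_sum fun p _ => sum_le_sum fun q _ => ?_
        simpa [card_columns] using (pairIrreg_le_augCutNorm G (c p q) _ _).trans
          (augCutNorm_le_add (abs_deviation_le_one G (hc p q)) (he p) (he q))
    _ = _ := by
        simp only [sum_add_distrib, ← mul_sum, sum_sub_distrib, sum_const, card_univ,
          nsmul_eq_mul, ← sum_mul, hB]
        ring

lemma sum_augCutNorm_columns_le_irreg (P : Finpartition (univ : Finset V)) {cl : ι → P.parts}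
    {e : Fin t × ι ↪ V} (he : ∀ r p, e (r, p) ∈ (cl p).1) :
    ∑ X, ∑ Y, augCutNorm (deviation G (G.edgeDensity X.1 Y.1)) (columns e {a | cl a = X})
      (columns e {a | cl a = Y}) ≤
      irreg G P + ((Fintype.card V : ℝ) ^ 2 - (Fintype.card ι * t) ^ 2) := by
  have hsub (X : P.parts) : columns e {a | cl a = X} ⊆ X := fun v hv => by
    simp only [columns, mem_map, mem_product, mem_univ, mem_filter, true_and, Prod.exists] at hv
    obtain ⟨r, p, rfl, rfl⟩ := hv
    exact he r p
  have hP : ∑ X : P.parts, (#X.1 : ℝ) = Fintype.card V := by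
    rw [sum_coe_sort P.parts fun X => (#X : ℝ)]
    exact_mod_cast P.sum_card_parts
  calc _ ≤ ∑ X : P.parts, ∑ Y : P.parts, (pairIrreg G X Y + (#X.1 * #Y.1 -
          #{a | cl a = X} * #{a | cl a = Y} * (t : ℝ) ^ 2)) := by
        refine sum_le_sum fun X _ => sum_le_sum fun Y _ => ?_
        rw [pairIrreg_eq_augCutNorm]
        refine (augCutNorm_le_add_of_subset (abs_deviation_le_one G (edgeDensity_mem_Icc G X Y))
          (hsub X) (hsub Y)).trans_eq ?_
        simp only [card_columns]
        push_cast
        ring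
    _ = irreg G P + ((∑ X : P.parts, (#X.1 : ℝ)) ^ 2 -
          (∑ X, (#{a | cl a = X} : ℝ)) ^ 2 * (t : ℝ) ^ 2) := by
        simp only [sum_add_distrib, sum_sub_distrib, ← mul_sum, ← sum_mul, sq (∑ _, _),
          irreg_eq_sum_coe]
    _ = _ := by rw [hP, sum_card_fiber, mul_pow]

lemma exists_equipartition_irreg_le (P : Finpartition (univ : Finset V)) (ht : 0 < t)
    (hP : #P.parts * t < Fintype.card V) :
    ∃ (K : ℕ) (Q : Finpartition (univ : Finset V)), Q.IsEquipartition ∧ #Q.parts = K ∧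
      K * t ≤ Fintype.card V ∧ Fintype.card V ≤ K * t + #P.parts * t ∧
      irreg G Q ≤ irreg G P + 8 * (K : ℝ) ^ 2 * (t * √t) + 3 * K * (t : ℝ) ^ 2 +
        3 * ((Fintype.card V : ℝ) ^ 2 - (K * t) ^ 2) := by
  obtain ⟨K, cl, e, he, hKle⟩ := exists_grid P ht
  rw [card_univ] at hKle
  have hK : 0 < K := Nat.pos_of_ne_zero fun h => by
    rw [h, zero_mul, zero_add] at hKle
    lia
  have hdensity (X Y : P.parts) := edgeDensity_mem_Icc G X.1 Y
  obtain ⟨e', he'⟩ := exists_sum_augCutNorm_column_le e cl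
    (f := fun X Y => deviation G (G.edgeDensity X.1 Y))
    fun X Y => abs_deviation_le_one G (hdensity X Y)
  obtain ⟨Q, B, hQ, hQB, hB⟩ := exists_equipartition_columns_subset ht hK e'
  refine ⟨K, Q, hQ, by simp [hQB], ?_, hKle, ?_⟩
  · simpa [mul_comm] using Fintype.card_le_of_embedding e
  · have hQle := irreg_le_sum_augCutNorm_columns G hQB hB fun p q => hdensity (cl p) (cl q)
    have hPge := sum_augCutNorm_columns_le_irreg G P he
    rw [Fintype.card_fin] at he' hQle hPge
    linarith

end Irregularity

section Parameters

variable {α : ℝ} {k n : ℕ}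

lemma exists_block_size (hα : 0 < α) (hα2 : α < 1 / 2) (hk : 0 < k) (hn : 2 ^ 14 * k < α ^ 3 * n) :
    ∃ t : ℕ, 0 < t ∧ 16 ≤ α * √t ∧ 18 * (k * t) ≤ α * n ∧ α * n ≤ 36 * (k * t) := by
  set τ : ℝ := α * n / (18 * k) with hτ
  have hk0 : (0 : ℝ) < k := mod_cast hk
  have hτk : τ * (18 * k) = α * n := by rw [hτ]; field_simp
  have hτ512 : 512 < α ^ 2 * τ := by
    refine lt_of_mul_lt_mul_right ?_ (by positivity : (0 : ℝ) ≤ 18 * k)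
    rw [mul_assoc, hτk]
    nlinarith
  have hτ1 : 1 ≤ τ := by
    have hα1 : α ^ 2 ≤ 1 := pow_le_one₀ hα.le (by linarith)
    nlinarith [show 0 ≤ τ by positivity]
  have ht : 1 ≤ ⌊τ⌋₊ := Nat.le_floor (mod_cast hτ1)
  have ht' : (1 : ℝ) ≤ ⌊τ⌋₊ := mod_cast ht
  have hle : (⌊τ⌋₊ : ℝ) ≤ τ := Nat.floor_le (zero_le_one.trans hτ1)
  have hlt : τ < ⌊τ⌋₊ + 1 := Nat.lt_floor_add_one τ
  refine ⟨⌊τ⌋₊, ht, ?_, by nlinarith, by nlinarith⟩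
  refine (div_le_iff₀' hα).1 (Real.le_sqrt_of_sq_le ?_)
  rw [div_pow, div_le_iff₀ (by positivity)]
  nlinarith [sq_pos_of_pos hα]

lemma block_errors_le {K t : ℕ} (hα : 0 ≤ α) (ht : 16 ≤ α * √t)
    (hkt : 18 * (k * t) ≤ α * n) (hk : 0 < k)
    (hKn : K * t ≤ n) (hnK : n ≤ K * t + k * t) :
    8 * (K : ℝ) ^ 2 * (t * √t) + 3 * K * (t : ℝ) ^ 2 + 3 * ((n : ℝ) ^ 2 - (K * t) ^ 2) ≤
      α * n ^ 2 := by
  have hKn' : (K * t : ℝ) ≤ n := mod_cast hKn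
  have hnK' : (n : ℝ) ≤ K * t + k * t := mod_cast hnK
  have hk' : (1 : ℝ) ≤ k := mod_cast hk
  have hsampling : 8 * (K : ℝ) ^ 2 * (t * √t) ≤ α / 2 * n ^ 2 :=
    calc 8 * (K : ℝ) ^ 2 * (t * √t) = 16 * (K ^ 2 * t * √t / 2) := by ring
      _ ≤ α * √t * (K ^ 2 * t * √t / 2) := by gcongr
      _ = α / 2 * (K ^ 2 * t * (√t * √t)) := by ring
      _ = α / 2 * (K * t) ^ 2 := by rw [Real.mul_self_sqrt (Nat.cast_nonneg t)]; ring
      _ ≤ α / 2 * n ^ 2 := by gcongr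
  have hdiagonal : 3 * (K : ℝ) * (t : ℝ) ^ 2 ≤ 3 * (k * t) * n :=
    calc 3 * (K : ℝ) * (t : ℝ) ^ 2 = 3 * (1 * t) * (K * t) := by ring
      _ ≤ 3 * (k * t) * n := by gcongr
  have hleftover : 3 * ((n : ℝ) ^ 2 - (K * t) ^ 2) ≤ 6 * (k * t) * n :=
    calc 3 * ((n : ℝ) ^ 2 - (K * t) ^ 2) = 3 * ((n - K * t) * (n + K * t)) := by ring
      _ ≤ 3 * ((k * t) * (n + n)) := by gcongr; linarith
      _ = 6 * (k * t) * n := by ring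
  nlinarith

variable {V : Type} [Fintype V] [DecidableEq V] (G : SimpleGraph V) [DecidableRel G.Adj]

lemma exists_equipartition_irreg_le_add (hα : 0 < α) (hα2 : α < 1 / 2)
    (P : Finpartition (univ : Finset V)) :
    ∃ Q : Finpartition (univ : Finset V), Q.IsEquipartition ∧ α ^ 17 * #Q.parts ≤ #P.parts ∧
      irreg G Q ≤ irreg G P + α * (Fintype.card V : ℝ) ^ 2 := by
  rcases le_or_gt (α ^ 3 * Fintype.card V) (2 ^ 14 * #P.parts) with hsmall | hlarge
  · refine ⟨⊥, Finpartition.bot_isEquipartition _, ?_, ?_⟩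
    · rw [Finpartition.card_bot, card_univ]
      calc α ^ 17 * (Fintype.card V : ℝ) = α ^ 14 * (α ^ 3 * Fintype.card V) := by ring
        _ ≤ (1 / 2) ^ 14 * (2 ^ 14 * (#P.parts : ℝ)) := by gcongr
        _ = (#P.parts : ℝ) := by ring
    · rw [irreg_bot]
      have := irreg_nonneg G P
      positivity
  · have hV : (0 : ℝ) < Fintype.card V :=
      pos_of_mul_pos_right ((by positivity : (0 : ℝ) ≤ _).trans_lt hlarge) (by positivity)
    have hk : 0 < #P.parts :=
      card_pos.2 (P.parts_nonempty (card_pos.1 (mod_cast hV)).ne_empty)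
    obtain ⟨t, ht, hsqrt, htle, htge⟩ := exists_block_size hα hα2 hk hlarge
    have hlt : #P.parts * t < Fintype.card V := by
      have : (#P.parts * t : ℝ) < Fintype.card V := by nlinarith
      exact_mod_cast this
    obtain ⟨K, Q, hQ, hQK, hKn, hnK, hirreg⟩ := exists_equipartition_irreg_le G P ht hlt
    refine ⟨Q, hQ, ?_, ?_⟩
    · have hK : α * K ≤ 36 * (#P.parts : ℝ) := by
        have hKn' : (K * t : ℝ) ≤ Fintype.card V := mod_cast hKn
        refine le_of_mul_le_mul_right ?_ (Nat.cast_pos.2 ht : (0 : ℝ) < t)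
        nlinarith
      rw [hQK]
      calc α ^ 17 * (K : ℝ) = α ^ 16 * (α * K) := by ring
        _ ≤ (1 / 2) ^ 16 * (36 * (#P.parts : ℝ)) := by gcongr
        _ ≤ (#P.parts : ℝ) := by linarith [(#P.parts).cast_nonneg (α := ℝ)]
    · linarith [block_errors_le hα.le hsqrt htle hk hKn hnK]

lemma floor_mem_sufficientEquitableParts {ε : ℝ} {m : ℕ} (hα : 0 < α) (hα2 : α < 1 / 2)
    (hm : m ∈ sufficientParts ε) : ⌊α ^ (-17 : ℝ) * m⌋₊ ∈ sufficientEquitableParts (ε + α) := by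
  intro V _ _ G _
  obtain ⟨P, hPm, hP⟩ := hm V G
  obtain ⟨Q, hQ, hQP, hirreg⟩ := exists_equipartition_irreg_le_add G hα hα2 P
  refine ⟨Q, hQ, Nat.le_floor ?_, by linarith⟩
  rw [Real.rpow_neg hα.le, le_inv_mul_iff₀ (by positivity)]
  calc α ^ (17 : ℝ) * (#Q.parts : ℝ) ≤ (#P.parts : ℝ) := mod_cast hQP
    _ ≤ m := mod_cast hPm

end Parameters

section Existence

variable {V : Type} (G : SimpleGraph V) [DecidableRel G.Adj] {η : ℝ}

variable {G} in
lemma pairIrreg_le_of_isUniform {X Y : Finset V} (h : G.IsUniform η X Y) :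
    pairIrreg G X Y ≤ η * (#X * #Y) := by
  have hη : 0 < η := h.pos
  rw [pairIrreg_eq_cutNorm]
  refine cutNorm_le fun U hU W hW => ?_
  have htrivial := abs_rectSum_le_mul_card
    (abs_deviation_le_one G (edgeDensity_mem_Icc G X Y)) U W
  rcases lt_or_ge (#U : ℝ) (#X * η) with hUsmall | hUlarge
  · calc _ ≤ (#U * #W : ℝ) := htrivial
      _ ≤ #X * η * #Y := by gcongr
      _ = η * (#X * #Y) := by ring
  rcases lt_or_ge (#W : ℝ) (#Y * η) with hWsmall | hWlarge
  · calc _ ≤ (#U * #W : ℝ) := htrivial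
      _ ≤ #X * (#Y * η) := by gcongr
      _ = η * (#X * #Y) := by ring
  rw [rectSum_deviation_eq_mul_sub, abs_mul, abs_of_nonneg (by positivity), mul_comm]
  have hdensity := (h hU hW hUlarge hWlarge).le
  gcongr

variable [DecidableEq V]

lemma pairIrreg_le_of_mem_parts (hη : 0 ≤ η) {s X Y : Finset V} {P : Finpartition s}
    (hX : X ∈ P.parts) (hY : Y ∈ P.parts) :
    pairIrreg G X Y ≤ η * (#X * #Y) + (if X = Y then (#X * #Y : ℝ) else 0) +
      if (X, Y) ∈ P.nonUniforms G η then (#X * #Y : ℝ) else 0 := by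
  have hηXY : 0 ≤ η * (#X * #Y) := by positivity
  by_cases hXY : X = Y ∨ (X, Y) ∈ P.nonUniforms G η
  · refine (pairIrreg_le_mul_card G X Y).trans ?_
    have : (0 : ℝ) ≤ #X * #Y := by positivity
    rcases hXY with h | h <;> rw [if_pos h] <;> split_ifs <;> linarith
  · obtain ⟨hne, hunif⟩ := not_or.1 hXY
    rw [if_neg hne, if_neg hunif, add_zero, add_zero]
    refine pairIrreg_le_of_isUniform (not_not.1 fun h => hunif ?_)
    exact (P.mk_mem_nonUniforms G).2 ⟨hX, hY, hne, h⟩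

lemma sum_nonUniforms_le {s : Finset V} {P : Finpartition s} (hη : 0 < η) (hs : s.Nonempty)
    (hP : P.IsEquipartition) (hG : P.IsUniform G η) :
    ∑ X ∈ P.parts, ∑ Y ∈ P.parts, (if (X, Y) ∈ P.nonUniforms G η then (#X * #Y : ℝ) else 0) ≤
      4 * η * (#s : ℝ) ^ 2 := by
  have hsub : P.nonUniforms G η ⊆ P.parts ×ˢ P.parts := fun p hp => by
    obtain ⟨hX, hY, -⟩ := (P.mk_mem_nonUniforms G).1 hp
    exact mk_mem_product hX hY
  have hparts : (#P.parts : ℝ) ≤ #s := mod_cast P.card_parts_le_card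
  rw [← sum_product', sum_ite_mem, inter_eq_right.2 hsub]
  calc _ ≤ η * ((#s : ℝ) + #P.parts) ^ 2 := (hP.sum_nonUniforms_lt' hs hη hG).le
    _ ≤ η * ((#s : ℝ) + #s) ^ 2 := by gcongr
    _ = 4 * η * (#s : ℝ) ^ 2 := by ring

lemma card_part_le {s X : Finset V} {P : Finpartition s} (hP : P.IsEquipartition)
    (hX : X ∈ P.parts) {l : ℕ} (hl : 0 < l) (hlP : l ≤ #P.parts) : (#X : ℝ) ≤ #s / l + 1 := by
  calc (#X : ℝ) ≤ (#s / #P.parts : ℕ) + 1 := mod_cast hP.card_part_le_average_add_one hX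
    _ ≤ (#s : ℝ) / #P.parts + 1 := by gcongr; exact Nat.cast_div_le
    _ ≤ #s / l + 1 := by gcongr

variable [Fintype V]

variable {G} in
lemma irreg_le_of_isUniform [Nonempty V] (hη : 0 < η) {P : Finpartition (univ : Finset V)}
    (hP : P.IsEquipartition) (hG : P.IsUniform G η) {c : ℝ} (hc : ∀ X ∈ P.parts, (#X : ℝ) ≤ c) :
    irreg G P ≤ 5 * η * (Fintype.card V : ℝ) ^ 2 + c * Fintype.card V := by
  have hsum : ∑ X ∈ P.parts, (#X : ℝ) = Fintype.card V := mod_cast P.sum_card_parts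
  have hdiag : ∑ X ∈ P.parts, ∑ Y ∈ P.parts, (if X = Y then (#X * #Y : ℝ) else 0) ≤
      c * Fintype.card V := by
    rw [← hsum, mul_sum]
    refine sum_le_sum fun X hX => ?_
    rw [sum_ite_eq, if_pos hX]
    exact mul_le_mul_of_nonneg_right (hc X hX) (Nat.cast_nonneg _)
  have hnonunif := sum_nonUniforms_le G hη univ_nonempty hP hG
  have hle := sum_le_sum fun X hX => sum_le_sum fun Y hY =>
    pairIrreg_le_of_mem_parts G hη.le (P := P) (X := X) (Y := Y) hX hY
  simp only [sum_add_distrib, ← mul_sum, ← sum_mul, hsum, card_univ] at hle hnonunif hdiag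
  unfold irreg
  linarith

lemma sufficientParts_nonempty {ε : ℝ} (hε : 0 < ε) : (sufficientParts ε).Nonempty := by
  set l := ⌈16 / ε⌉₊
  have hlε : 16 / ε ≤ l := Nat.le_ceil _
  have hl : 0 < l := Nat.ceil_pos.2 (by positivity)
  refine ⟨max l (SzemerediRegularity.bound (ε / 16) l), fun V _ _ G _ => ?_⟩
  rcases le_or_gt l (Fintype.card V) with hV | hV
  · obtain ⟨P, hP, hlP, hbound, hunif⟩ := szemeredi_regularity G (by positivity : 0 < ε / 16) hV
    refine ⟨P, hbound.trans (le_max_right _ _), ?_⟩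
    have : Nonempty V := Fintype.card_pos_iff.1 (hl.trans_le hV)
    have hle := irreg_le_of_isUniform (by positivity) hP hunif
      fun X hX => card_part_le hP hX hl hlP
    rw [card_univ] at hle
    set n : ℝ := (Fintype.card V : ℝ)
    have hlε' : 16 ≤ ε * l := (div_le_iff₀' hε).1 hlε
    have hln : (l : ℝ) ≤ n := Nat.cast_le.2 hV
    have hblock : n / l ≤ ε / 16 * n := by
      rw [div_le_iff₀ (by positivity)]
      nlinarith
    have hone : 1 ≤ ε / 16 * n := by nlinarith
    calc irreg G P ≤ 5 * (ε / 16) * n ^ 2 + (n / l + 1) * n := hle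
      _ ≤ 5 * (ε / 16) * n ^ 2 + (ε / 16 * n + ε / 16 * n) * n := by gcongr
      _ ≤ ε * n ^ 2 := by nlinarith [sq_nonneg n]
  · refine ⟨⊥, ?_, ?_⟩
    · rw [Finpartition.card_bot, card_univ]
      exact hV.le.trans (le_max_left _ _)
    · rw [irreg_bot]
      positivity

end Existence

end EquitableRegularity

end

/-- There is an absolute constant `C` with `M_eq(ε + α) ≤ α ^ (-C) M(ε)`. The first two conjuncts
say that both sides are genuine minima: the sets whose least elements they are meant to be are
not empty. -/
theorem theorem2p2 :
    ∃ C : ℝ, 0 < C ∧ ∀ ε α : ℝ, 0 < ε → ε < 1 → 0 < α → α < 1 / 2 →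
      IsLeast (EquitableRegularity.sufficientParts ε) (EquitableRegularity.M ε) ∧
      IsLeast (EquitableRegularity.sufficientEquitableParts (ε + α))
        (EquitableRegularity.Meq (ε + α)) ∧
      (EquitableRegularity.Meq (ε + α) : ℝ) ≤ α ^ (-C) * (EquitableRegularity.M ε : ℝ) := by
  refine ⟨17, by norm_num, fun ε α hε _ hα hα2 => ?_⟩
  have hM := Nat.sInf_mem (EquitableRegularity.sufficientParts_nonempty hε)
  have hMeq := EquitableRegularity.floor_mem_sufficientEquitableParts hα hα2 hM
  refine ⟨⟨hM, fun m hm => Nat.sInf_le hm⟩,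
    ⟨Nat.sInf_mem ⟨_, hMeq⟩, fun m hm => Nat.sInf_le hm⟩, ?_⟩
  have hfloor : (⌊α ^ (-17 : ℝ) * EquitableRegularity.M ε⌋₊ : ℝ) ≤
      α ^ (-17 : ℝ) * EquitableRegularity.M ε := Nat.floor_le (by positivity)
  exact (Nat.cast_le.2 (Nat.sInf_le hMeq)).trans hfloor
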